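/- Let $G$ be a non-compact, second countable, locally compact (Hausdorff) group with a left Haar measure $\mu$, let $1\le p<\infty$, and let $\omega:G\to(0,\infty)$ be a continuous function such that for every $g\in G$ $$L(g)=\sup_{t\in G}\frac{\omega(gt)}{\omega(t)}<\infty,\qquad R(g)=\sup_{t\in G}\frac{\omega(tg)}{\omega(t)}<\infty .$$ Let $L^p(G,\omega)$ be the space of measurable functions $f:G\to\mathbb{C}$ (modulo equality almost everywhere) with $\|f\|_{p,\omega}=\big(\int_G|f\omega|^p\,d\mu\big)^{1/p}<\infty$, and for $s\in G$ let $(T_sf)(t)=f(s^{-1}t)$. For $S\subset G$, a function $f\in L^p(G,\omega)$ is called $S$-dense if $\{T_sf:s\in S\}$ is dense in $L^p(G,\omega)$. Then for every subset $S\subset G$ the following conditions are equivalent: 1. there is an $S$-dense function in $L^p(G,\omega)$; 2. $\displaystyle\inf_{s\in S}\ \sup_{t\in sK\cup s^{-1}K}\omega(t)=0$ for every compact set $K\subset G$; 3. $\displaystyle\inf_{s\in S}\ \max\big(\omega(s),\omega(s^{-1})\big)=0$. Here suprema and infima are taken in $[0,\infty]$; in particular the infimum over $S=\emptyset$ is $+\infty$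 and the supremum over the empty set is $0$. -/

import Mathlib

open MeasureTheory
open scoped Pointwise ENNReal

namespace WeightedTranslation

/-- The left translate `T_s f` of a function `f`, i.e. `(T_s f)(t) = f(s⁻¹ t)`. -/
def translate {G : Type*} [Group G] (s : G) (f : G → ℂ) : G → ℂ :=
  fun t => f (s⁻¹ * t)

/-- `f ∈ L^p(G, ω)`, i.e. `f ω ∈ L^p(G)`. -/
def MemWeightedLp {G : Type*} [MeasurableSpace G] (μ : Measure G) (p : ℝ≥0∞) (ω : G → ℝ)
    (f : G → ℂ) : Prop :=
  MemLp (fun t => f t * (ω t : ℂ)) p μ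

/-- The weighted norm `‖f‖_{p,ω} = (∫ |f ω|^p dμ)^{1/p}`, with values in `[0, ∞]`. -/
noncomputable def weightedNorm {G : Type*} [MeasurableSpace G] (μ : Measure G) (p : ℝ≥0∞)
    (ω : G → ℝ) (f : G → ℂ) : ℝ≥0∞ :=
  eLpNorm (fun t => f t * (ω t : ℂ)) p μ

/-- `f ∈ L^p(G, ω)` is `S`-dense: its orbit `{T_s f : s ∈ S}` is contained in `L^p(G, ω)` and is
dense there for the weighted norm. -/
structure IsSDense {G : Type*} [Group G] [MeasurableSpace G] (μ : Measure G) (p : ℝ≥0∞)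
    (ω : G → ℝ) (S : Set G) (f : G → ℂ) : Prop where
  mem : MemWeightedLp μ p ω f
  orbit_mem : ∀ s ∈ S, MemWeightedLp μ p ω (translate s f)
  dense : ∀ g : G → ℂ, MemWeightedLp μ p ω g → ∀ ε : ℝ≥0∞, 0 < ε →
    ∃ s ∈ S, weightedNorm μ p ω (translate s f - g) < ε

/-- `L(g) = sup_t ω(g t) / ω(t)`, in `[0, ∞]`. -/
noncomputable def leftNorm {G : Type*} [Group G] (ω : G → ℝ) (g : G) : ℝ≥0∞ :=
  ⨆ t : G, ENNReal.ofReal (ω (g * t) / ω t)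

/-- `R(g) = sup_t ω(t g) / ω(t)`, in `[0, ∞]`. -/
noncomputable def rightNorm {G : Type*} [Group G] (ω : G → ℝ) (g : G) : ℝ≥0∞ :=
  ⨆ t : G, ENNReal.ofReal (ω (t * g) / ω t)

end WeightedTranslation

namespace WeightedTranslation

open Filter Topology

/-! ### Growth of the weight under translations. -/

section Weight

variable {G : Type*} [Group G] {ω : G → ℝ}

/-! Everything passes through condition 3. By Baire category, `R` is bounded on compact sets
(`exists_le_mul_of_isCompact`), so `ω` on `sK` is controlled by `ω s`: this gives 2 from 3, while `K
= {1}` gives the converse.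

Necessity: let `T_s f` be close to `n 1_K`. Its mass on `K` is then large, which forces `ω s⁻¹` to
be small. Fix a translate `K'` of `K` on which `f` does not vanish. Once `ω s⁻¹` is small, `sK'`
misses `K`, so the part of `T_s f` living on `sK'` is pure error; hence `ω s` is small too.

Sufficiency: list a dense sequence of compactly supported continuous functions as `g_k`, each
infinitely often, and set `f = ∑ T_{s_k⁻¹} g_k`. If the `s_k` make `ω (s_k⁻¹)` and `ω (s_n s_k⁻¹)`
decay fast enough, the series converges and `T_{s_n} f` differs from `g_n` by at most `2 · 2⁻ⁿ`. -/

theorem exists_le_mul_of_leftNorm_lt_top (hω : ∀ t, 0 < ω t) {g : G}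
    (h : leftNorm ω g < ∞) : ∃ C > 0, ∀ t, ω (g * t) ≤ C * ω t := by
  have hle : ∀ t, ω (g * t) ≤ (leftNorm ω g).toReal * ω t := fun t => by
    rw [← div_le_iff₀ (hω t), ← ENNReal.ofReal_le_iff_le_toReal h.ne]
    exact le_iSup (fun t => ENNReal.ofReal (ω (g * t) / ω t)) t
  refine ⟨_, ?_, hle⟩
  exact pos_of_mul_pos_left ((hω _).trans_le (hle 1)) (hω 1).le

theorem exists_le_mul_of_rightNorm_lt_top (hω : ∀ t, 0 < ω t) {g : G}
    (h : rightNorm ω g < ∞) : ∃ C > 0, ∀ t, ω (t * g) ≤ C * ω t := by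
  have hle : ∀ t, ω (t * g) ≤ (rightNorm ω g).toReal * ω t := fun t => by
    rw [← div_le_iff₀ (hω t), ← ENNReal.ofReal_le_iff_le_toReal h.ne]
    exact le_iSup (fun t => ENNReal.ofReal (ω (t * g) / ω t)) t
  refine ⟨_, ?_, hle⟩
  exact pos_of_mul_pos_left ((hω _).trans_le (hle 1)) (hω 1).le

/-- By Baire category, the right translation constants of a continuous weight are locally
bounded. -/
theorem exists_le_mul_of_isCompact [TopologicalSpace G] [IsTopologicalGroup G] [BaireSpace G]
    (hω : ∀ t, 0 < ω t) (hc : Continuous ω)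
    (hR : ∀ g, ∃ C > 0, ∀ t, ω (t * g) ≤ C * ω t) {K : Set G} (hK : IsCompact K) :
    ∃ C > 0, ∀ k ∈ K, ∀ t, ω (t * k) ≤ C * ω t := by
  obtain ⟨n, g₀, hg₀⟩ : ∃ n : ℕ, (interior {g : G | ∀ t, ω (t * g) ≤ n * ω t}).Nonempty := by
    apply nonempty_interior_of_iUnion_of_closed
    · intro n
      simp only [Set.ofPred_forall]
      exact isClosed_iInter fun t => isClosed_le (by fun_prop) (by fun_prop)
    · refine Set.eq_univ_of_forall fun g => Set.mem_iUnion.2 ?_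
      obtain ⟨C, -, hC⟩ := hR g
      obtain ⟨n, hn⟩ := exists_nat_ge C
      exact ⟨n, fun t => (hC t).trans (mul_le_mul_of_nonneg_right hn (hω t).le)⟩
  refine hK.induction_on (p := fun K => ∃ C > 0, ∀ k ∈ K, ∀ t, ω (t * k) ≤ C * ω t)
    ⟨1, one_pos, by simp⟩ ?_ ?_ ?_
  · rintro A B hAB ⟨C, hC, h⟩
    exact ⟨C, hC, fun k hk => h k (hAB hk)⟩
  · rintro A B ⟨C, hC, h⟩ ⟨D, hD, h'⟩
    refine ⟨max C D, lt_max_of_lt_left hC, ?_⟩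
    rintro k (hk | hk) t
    · exact (h k hk t).trans (mul_le_mul_of_nonneg_right (le_max_left _ _) (hω t).le)
    · exact (h' k hk t).trans (mul_le_mul_of_nonneg_right (le_max_right _ _) (hω t).le)
  -- Near `k`, write `x = (k g₀⁻¹) (g₀ k⁻¹ x)`: the second factor stays in the set around `g₀` where
  -- `n` works.
  · intro k _
    obtain ⟨C, hC, h⟩ := hR (k * g₀⁻¹)
    have hmem : (fun x => g₀ * (k⁻¹ * x)) ⁻¹' {g : G | ∀ t, ω (t * g) ≤ n * ω t} ∈ 𝓝 k := by
      apply ContinuousAt.preimage_mem_nhds (by fun_prop)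
      simpa using mem_interior_iff_mem_nhds.1 hg₀
    refine ⟨_, mem_nhdsWithin_of_mem_nhds hmem, (n + 1) * C, by positivity, fun x hx t => ?_⟩
    have h1 := hx (t * (k * g₀⁻¹))
    have h2 : t * (k * g₀⁻¹) * (g₀ * (k⁻¹ * x)) = t * x := by group
    rw [h2] at h1
    nlinarith [h t, hω (t * (k * g₀⁻¹)), hω t, mul_le_mul_of_nonneg_left (h t) n.cast_nonneg,
      mul_pos hC (hω t)]

/-- A continuous positive weight is bounded below on compact sets. -/
theorem exists_pos_le_of_isCompact {G : Type*} [TopologicalSpace G] {ω : G → ℝ} (hω : ∀ t, 0 < ω t)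
    (hc : Continuous ω) {K : Set G} (hK : IsCompact K) : ∃ a > 0, ∀ t ∈ K, a ≤ ω t := by
  rcases K.eq_empty_or_nonempty with rfl | hne
  · exact ⟨1, one_pos, by simp⟩
  · obtain ⟨x, -, hx⟩ := hK.exists_isMinOn hne hc.continuousOn
    exact ⟨ω x, hω x, fun t ht => hx ht⟩

theorem iInf_max_eq_zero_iff {S : Set G} :
    (⨅ s ∈ S, ENNReal.ofReal (max (ω s) (ω s⁻¹))) = 0 ↔
      ∀ ε > 0, ∃ s ∈ S, ω s < ε ∧ ω s⁻¹ < ε := by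
  constructor
  · intro h ε hε
    have hlt : (⨅ s ∈ S, ENNReal.ofReal (max (ω s) (ω s⁻¹))) < ENNReal.ofReal ε := by
      rw [h]
      exact ENNReal.ofReal_pos.2 hε
    obtain ⟨s, hs, hlt⟩ := by simpa only [iInf_lt_iff] using hlt
    rw [ENNReal.ofReal_lt_ofReal_iff hε, max_lt_iff] at hlt
    exact ⟨s, hs, hlt⟩
  · intro h
    refine le_antisymm (ENNReal.le_of_forall_pos_le_add fun ε hε _ => ?_) zero_le
    obtain ⟨s, hs, h1, h2⟩ := h ε hε
    refine (iInf₂_le s hs).trans ?_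
    rw [zero_add]
    exact ENNReal.ofReal_le_of_le_toReal (by simpa using ⟨h1.le, h2.le⟩)

theorem iInf_iSup_eq_zero_of_iInf_max_eq_zero [TopologicalSpace G] [IsTopologicalGroup G]
    [BaireSpace G] (hω : ∀ t, 0 < ω t) (hc : Continuous ω)
    (hR : ∀ g, ∃ C > 0, ∀ t, ω (t * g) ≤ C * ω t) {S : Set G}
    (h : (⨅ s ∈ S, ENNReal.ofReal (max (ω s) (ω s⁻¹))) = 0) {K : Set G} (hK : IsCompact K) :
    (⨅ s ∈ S, ⨆ t ∈ s • K ∪ s⁻¹ • K, ENNReal.ofReal (ω t)) = 0 := by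
  obtain ⟨C, hC, hCK⟩ := exists_le_mul_of_isCompact hω hc hR hK
  refine le_antisymm (ENNReal.le_of_forall_pos_le_add fun ε hε _ => ?_) zero_le
  obtain ⟨s, hs, h1, h2⟩ := iInf_max_eq_zero_iff.1 h (ε / C) (by positivity)
  rw [lt_div_iff₀' hC] at h1 h2
  refine (iInf₂_le s hs).trans (iSup₂_le ?_)
  rw [zero_add]
  rintro _ (⟨k, hk, rfl⟩ | ⟨k, hk, rfl⟩)
  · exact ENNReal.ofReal_le_of_le_toReal ((hCK k hk _).trans h1.le)
  · exact ENNReal.ofReal_le_of_le_toReal ((hCK k hk _).trans h2.le)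

theorem iInf_max_eq_zero_of_iInf_iSup_eq_zero {S : Set G}
    (h : (⨅ s ∈ S, ⨆ t ∈ s • ({1} : Set G) ∪ s⁻¹ • {1}, ENNReal.ofReal (ω t)) = 0) :
    (⨅ s ∈ S, ENNReal.ofReal (max (ω s) (ω s⁻¹))) = 0 := by
  refine le_antisymm (le_trans (iInf₂_mono fun s _ => ?_) h.le) zero_le
  rw [ENNReal.ofReal_max]
  refine max_le ?_ ?_
  · exact le_iSup₂ (f := fun t (_ : t ∈ s • ({1} : Set G) ∪ s⁻¹ • {1}) => ENNReal.ofReal (ω t))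
      s (by simp)
  · exact le_iSup₂ (f := fun t (_ : t ∈ s • ({1} : Set G) ∪ s⁻¹ • {1}) => ENNReal.ofReal (ω t))
      s⁻¹ (by simp)

end Weight

/-! ### The weighted norm. -/

section WeightedNorm

variable {G : Type*} [TopologicalSpace G] [MeasurableSpace G] [BorelSpace G] {μ : Measure G}
  {p : ℝ≥0∞} {ω : G → ℝ}

theorem memWeightedLp_iff (hω : ∀ t, 0 < ω t) (hc : Continuous ω) {f : G → ℂ} :
    MemWeightedLp μ p ω f ↔ AEStronglyMeasurable f μ ∧ weightedNorm μ p ω f < ∞ := by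
  have hm : Measurable fun t => (ω t : ℂ) := (Complex.continuous_ofReal.comp hc).measurable
  refine and_congr_left fun _ => ⟨fun h => ?_, fun h => h.mul hm.aestronglyMeasurable⟩
  refine (h.mul hm.inv.aestronglyMeasurable).congr (ae_of_all _ fun t => ?_)
  have : (ω t : ℂ) ≠ 0 := by exact_mod_cast (hω t).ne'
  simp [this]

theorem weightedNorm_add_le (hp : 1 ≤ p) (hc : Continuous ω) {f g : G → ℂ}
    (hf : AEStronglyMeasurable f μ) (hg : AEStronglyMeasurable g μ) :
    weightedNorm μ p ω (f + g) ≤ weightedNorm μ p ω f + weightedNorm μ p ω g := by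
  have hm : Measurable fun t => (ω t : ℂ) := (Complex.continuous_ofReal.comp hc).measurable
  refine le_trans (le_of_eq ?_)
    (eLpNorm_add_le (hf.mul hm.aestronglyMeasurable) (hg.mul hm.aestronglyMeasurable) hp)
  simp only [weightedNorm]
  congr 1
  ext t
  simp [add_mul]

theorem weightedNorm_sum_le (hp : 1 ≤ p) (hc : Continuous ω) {ι : Type*} (f : ι → G → ℂ)
    (hf : ∀ i, AEStronglyMeasurable (f i) μ) (I : Finset ι) :
    weightedNorm μ p ω (∑ i ∈ I, f i) ≤ ∑ i ∈ I, weightedNorm μ p ω (f i) := by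
  classical
  induction I using Finset.induction_on with
  | empty => simp [weightedNorm]
  | insert a I ha ih =>
    rw [Finset.sum_insert ha, Finset.sum_insert ha]
    exact (weightedNorm_add_le hp hc (hf a) (Finset.aestronglyMeasurable_sum _ fun i _ => hf i)).trans
      (by gcongr)

end WeightedNorm

/-! ### Translation operators. -/

section Translate

variable {G : Type*} [Group G] [MeasurableSpace G] {μ : Measure G} {p : ℝ≥0∞} {ω : G → ℝ}

theorem eLpNorm_comp_mul_left [MeasurableMul G] [μ.IsMulLeftInvariant] (h : G → ℂ) (s : G) :
    eLpNorm (fun t => h (s * t)) p μ = eLpNorm h p μ := by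
  have := (measurableEmbedding_mulLeft s).eLpNorm_map_measure (μ := μ) (p := p) (g := h)
  rw [map_mul_left_eq_self] at this
  exact this.symm

/-- Left invariance of `μ` moves the translation from the function to the weight. -/
theorem weightedNorm_translate [MeasurableMul G] [μ.IsMulLeftInvariant] (f : G → ℂ) (s : G) :
    weightedNorm μ p ω (translate s f) = eLpNorm (fun t => f t * (ω (s * t) : ℂ)) p μ := by
  rw [weightedNorm, ← eLpNorm_comp_mul_left _ s]
  simp [translate]

theorem weightedNorm_translate_le [MeasurableMul G] [μ.IsMulLeftInvariant]
    (hω : ∀ t, 0 < ω t) {s : G} {C : ℝ} (hC : ∀ t, ω (s * t) ≤ C * ω t) (f : G → ℂ) :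
    weightedNorm μ p ω (translate s f) ≤ ENNReal.ofReal C * weightedNorm μ p ω f := by
  rw [weightedNorm_translate]
  refine eLpNorm_le_mul_eLpNorm_of_ae_le_mul (ae_of_all _ fun t => ?_) p
  simp only [norm_mul, Complex.norm_real, Real.norm_of_nonneg (hω _).le]
  nlinarith [hC t, norm_nonneg (f t), mul_le_mul_of_nonneg_left (hC t) (norm_nonneg (f t))]

theorem aestronglyMeasurable_translate [MeasurableMul G] [μ.IsMulLeftInvariant] {f : G → ℂ}
    (hf : AEStronglyMeasurable f μ) (s : G) : AEStronglyMeasurable (translate s f) μ :=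
  hf.comp_measurePreserving (measurePreserving_mul_left μ s⁻¹)

end Translate

/-! ### Density of an orbit forces condition 3. -/

section Necessity

variable {G : Type*} [Group G] [TopologicalSpace G] [IsTopologicalGroup G]
  [MeasurableSpace G] [BorelSpace G] {μ : Measure G} [μ.IsMulLeftInvariant] {p : ℝ≥0∞} {ω : G → ℝ}

theorem eLpNorm_indicator_translate (K : Set G) (f : G → ℂ) (s : G) :
    eLpNorm (K.indicator (translate s f)) p μ = eLpNorm ((s⁻¹ • K).indicator f) p μ := by
  rw [← eLpNorm_comp_mul_left ((s⁻¹ • K).indicator f) s⁻¹]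
  congr 1
  ext t
  by_cases ht : t ∈ K
  · rw [Set.indicator_of_mem ht, ← smul_eq_mul, Set.indicator_of_mem (Set.smul_mem_smul_set ht)]
    rfl
  · rw [Set.indicator_of_notMem ht, Set.indicator_of_notMem]
    rwa [← smul_eq_mul, Set.smul_mem_smul_set_iff]

/-- Triangle inequality on `K`, where `ω ≥ a` lets the weighted norm dominate the unweighted one. It
shows that approximating a large multiple of `1_K` requires large mass on `K`. -/
theorem eLpNorm_indicator_const_le_add {G : Type*} [MeasurableSpace G] {μ : Measure G}
    {ω : G → ℝ} (hp : 1 ≤ p) (hω : ∀ t, 0 < ω t) {K : Set G} (hKm : MeasurableSet K)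
    {a : ℝ} (ha : 0 < a) (haK : ∀ t ∈ K, a ≤ ω t)
    {f : G → ℂ} (hf : AEStronglyMeasurable f μ) (c : ℂ) :
    eLpNorm (K.indicator fun _ => c) p μ ≤ eLpNorm (K.indicator f) p μ +
      ENNReal.ofReal a⁻¹ * weightedNorm μ p ω (f - K.indicator fun _ => c) := by
  have hsub : (K.indicator fun _ => c) =
      K.indicator f - K.indicator (f - K.indicator fun _ => c) := by
    ext t
    by_cases ht : t ∈ K <;> simp [ht]
  have hgm : AEStronglyMeasurable (K.indicator fun _ => c) μ :=
    (measurable_const.indicator hKm).aestronglyMeasurable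
  conv_lhs => rw [hsub]
  refine (eLpNorm_sub_le (hf.indicator hKm) ((hf.sub hgm).indicator hKm) hp).trans ?_
  gcongr
  refine eLpNorm_le_mul_eLpNorm_of_ae_le_mul (ae_of_all _ fun t => ?_) p
  by_cases ht : t ∈ K
  · simp only [ht, Set.indicator_of_mem, norm_mul, Complex.norm_real,
      Real.norm_of_nonneg (hω t).le]
    rw [← mul_assoc, mul_comm a⁻¹, mul_assoc]
    refine le_mul_of_one_le_right (norm_nonneg _) ?_
    rw [← div_eq_inv_mul, one_le_div ha]
    exact haK t ht
  · rw [Set.indicator_of_notMem ht, norm_zero]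
    positivity

/-- For `t ∈ K`, `ω s⁻¹ = ω (s⁻¹ t t⁻¹) ≤ M ω (s⁻¹ t)`. So large mass of `T_s f` on `K` forces `ω
s⁻¹` to be small. -/
theorem eLpNorm_indicator_translate_le (hω : ∀ t, 0 < ω t) {K : Set G} {M : ℝ} (hM0 : 0 < M)
    (hM : ∀ k ∈ K⁻¹, ∀ t, ω (t * k) ≤ M * ω t) (f : G → ℂ) (s : G) :
    eLpNorm (K.indicator (translate s f)) p μ ≤
      ENNReal.ofReal (M / ω s⁻¹) * weightedNorm μ p ω f := by
  rw [weightedNorm, ← eLpNorm_comp_mul_left (fun t => f t * (ω t : ℂ)) s⁻¹]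
  refine eLpNorm_le_mul_eLpNorm_of_ae_le_mul (ae_of_all _ fun t => ?_) p
  by_cases ht : t ∈ K
  · have h := hM t⁻¹ (by simpa using ht) (s⁻¹ * t)
    rw [mul_inv_cancel_right] at h
    simp only [ht, Set.indicator_of_mem, norm_mul, Complex.norm_real,
      Real.norm_of_nonneg (hω _).le, translate]
    rw [mul_left_comm]
    refine le_mul_of_one_le_right (norm_nonneg _) ?_
    rwa [div_mul_eq_mul_div, one_le_div (hω _)]
  · rw [Set.indicator_of_notMem ht, norm_zero]
    have := hω s⁻¹
    positivity

/-- On `sK'` the target `c 1_K` vanishes, so the error there is `T_s f` itself, weighted by at least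
`ω s / M`. -/
theorem eLpNorm_indicator_le_of_disjoint (hω : ∀ t, 0 < ω t) {K K' : Set G} {M : ℝ} (hM0 : 0 < M)
    (hM : ∀ k ∈ K'⁻¹, ∀ t, ω (t * k) ≤ M * ω t) (f : G → ℂ) (c : ℂ) {s : G}
    (hs : ∀ t ∈ K', s * t ∉ K) :
    eLpNorm (K'.indicator f) p μ ≤ ENNReal.ofReal (M / ω s) *
      weightedNorm μ p ω (translate s f - K.indicator fun _ => c) := by
  rw [weightedNorm, ← eLpNorm_comp_mul_left
    (fun t => (translate s f - K.indicator fun _ => c) t * (ω t : ℂ)) s]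
  refine eLpNorm_le_mul_eLpNorm_of_ae_le_mul (ae_of_all _ fun t => ?_) p
  have := hω s
  by_cases ht : t ∈ K'
  · have h := hM t⁻¹ (by simpa using ht) (s * t)
    rw [mul_inv_cancel_right] at h
    simp only [ht, hs t ht, Set.indicator_of_mem, norm_mul, Complex.norm_real, Pi.sub_apply,
      Real.norm_of_nonneg (hω _).le, translate, inv_mul_cancel_left, not_false_eq_true,
      Set.indicator_of_notMem, sub_zero]
    rw [mul_left_comm]
    refine le_mul_of_one_le_right (norm_nonneg _) ?_
    rwa [div_mul_eq_mul_div, one_le_div (hω _)]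
  · rw [Set.indicator_of_notMem ht, norm_zero]
    positivity

theorem iInf_max_eq_zero_of_isSDense [T2Space G] [LocallyCompactSpace G]
    [IsFiniteMeasureOnCompacts μ] [μ.IsOpenPosMeasure]
    (hp : 1 ≤ p) (hp_top : p ≠ ∞) (hω : ∀ t, 0 < ω t) (hc : Continuous ω)
    (hR : ∀ g, ∃ C > 0, ∀ t, ω (t * g) ≤ C * ω t) {S : Set G} {f : G → ℂ}
    (hf : IsSDense μ p ω S f) :
    (⨅ s ∈ S, ENNReal.ofReal (max (ω s) (ω s⁻¹))) = 0 := by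
  have hp0 : p ≠ 0 := (zero_lt_one.trans_le hp).ne'
  obtain ⟨K, hK, hK1⟩ := exists_compact_mem_nhds (1 : G)
  have hKm : MeasurableSet K := hK.isClosed.measurableSet
  obtain ⟨a, ha, haK⟩ := exists_pos_le_of_isCompact hω hc hK
  obtain ⟨M, hM, hMK⟩ := exists_le_mul_of_isCompact hω hc hR hK.inv
  obtain ⟨W, hW⟩ := hK.exists_bound_of_continuousOn hc.continuousOn
  have hκ : μ K ^ (1 / p.toReal) ≠ 0 := by
    have h0 : μ K ≠ 0 := (μ.measure_pos_of_mem_nhds hK1).ne'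
    simp [ENNReal.rpow_eq_zero_iff, h0, hK.measure_lt_top.ne]
  obtain ⟨hfm, hfn⟩ := (memWeightedLp_iff hω hc).1 hf.mem
  have hmem : ∀ c : ℂ, MemWeightedLp μ p ω (K.indicator fun _ => c) := by
    intro c
    rw [memWeightedLp_iff hω hc]
    refine ⟨(measurable_const.indicator hKm).aestronglyMeasurable, lt_of_le_of_lt
      (eLpNorm_le_mul_eLpNorm_of_ae_le_mul (c := W) (g := K.indicator fun _ => c)
        (ae_of_all _ fun t => ?_) p) ?_⟩
    · by_cases ht : t ∈ K
      · simp only [ht, Set.indicator_of_mem, norm_mul, Complex.norm_real]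
        rw [mul_comm]
        exact mul_le_mul_of_nonneg_right (hW t ht) (norm_nonneg _)
      · simp [ht]
    · rw [eLpNorm_indicator_const hKm hp0 hp_top]
      exact ENNReal.mul_lt_top ENNReal.ofReal_lt_top (ENNReal.mul_lt_top (by simp)
        (ENNReal.rpow_lt_top_of_nonneg (by positivity) hK.measure_lt_top.ne))
  have key : ∀ B : ℝ≥0∞, B ≠ ∞ → ∀ ε : ℝ≥0∞, 0 < ε → ε ≤ 1 → ∃ s ∈ S, ∃ c : ℂ,
      B < eLpNorm (K.indicator (translate s f)) p μ ∧
      weightedNorm μ p ω (translate s f - K.indicator fun _ => c) < ε := by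
    intro B hB ε hε hε1
    obtain ⟨n, hn⟩ := ENNReal.exists_nat_mul_gt hκ
      (b := B + ENNReal.ofReal a⁻¹) (by simp [hB])
    obtain ⟨s, hs, hlt⟩ := hf.dense _ (hmem n) ε hε
    refine ⟨s, hs, n, ?_, hlt⟩
    have h1 := eLpNorm_indicator_const_le_add hp hω hKm ha haK
      (aestronglyMeasurable_translate hfm s) (n : ℂ)
    rw [eLpNorm_indicator_const hKm hp0 hp_top] at h1
    have h2 : ‖(n : ℂ)‖ₑ = n := by
      rw [← ofReal_norm, Complex.norm_natCast, ENNReal.ofReal_natCast]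
    rw [h2] at h1
    have h3 : ENNReal.ofReal a⁻¹ * weightedNorm μ p ω (translate s f - K.indicator fun _ => (n : ℂ))
        ≤ ENNReal.ofReal a⁻¹ := mul_le_of_le_one_right' (hlt.le.trans hε1)
    have h4 := (hn.trans_le h1).trans_le (add_le_add_right h3 _)
    exact lt_of_add_lt_add_right h4
  -- With `B = 0` this only yields a translate `s₀⁻¹ • K` on which `f` is not almost everywhere
  -- zero.
  obtain ⟨s₀, -, -, hs₀, -⟩ := key 0 ENNReal.zero_ne_top 1 one_pos le_rfl
  rw [eLpNorm_indicator_translate] at hs₀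
  have hK' : IsCompact (s₀⁻¹ • K) := hK.smul _
  obtain ⟨M', hM', hMK'⟩ := exists_le_mul_of_isCompact hω hc hR hK'.inv
  obtain ⟨b, hb, hbK⟩ := exists_pos_le_of_isCompact hω hc (hK'.mul hK.inv)
  rw [iInf_max_eq_zero_iff]
  intro η hη
  obtain ⟨ε, hε, hεlt⟩ := ENNReal.exists_nnreal_pos_mul_lt
    (a := ENNReal.ofReal (M' / η)) ENNReal.ofReal_ne_top hs₀.ne'
  obtain ⟨s, hs, c, h1, h2⟩ := key (ENNReal.ofReal (M / min η b) * weightedNorm μ p ω f)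
    (ENNReal.mul_ne_top ENNReal.ofReal_ne_top hfn.ne) (min ε 1) (by simp [hε]) (min_le_right _ _)
  have hsi : ω s⁻¹ < min η b := by
    by_contra! hle
    refine h1.not_ge ((eLpNorm_indicator_translate_le hω hM hMK f s).trans ?_)
    gcongr
  refine ⟨s, hs, ?_, hsi.trans_le (min_le_left _ _)⟩
  by_contra! hle
  -- If `s t ∈ K`, then `s⁻¹ = t (s t)⁻¹` lies in the compact set where `ω ≥ b`, against `ω s⁻¹ <
  -- b`.
  have hdisj : ∀ t ∈ s₀⁻¹ • K, s * t ∉ K := by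
    intro t ht hst
    refine (hsi.trans_le (min_le_right _ _)).not_ge (hbK _ ⟨t, ht, (s * t)⁻¹, ?_, ?_⟩)
    · simpa using hst
    · simp
  refine hεlt.not_ge ((eLpNorm_indicator_le_of_disjoint hω hM' hMK' f c hdisj).trans ?_)
  rw [mul_comm]
  gcongr
  exact h2.le.trans (min_le_left _ _)

end Necessity

/-! ### Construction of an `S`-dense function. -/

section Sufficiency

variable {G : Type*} [Group G] [TopologicalSpace G] [IsTopologicalGroup G]
  [MeasurableSpace G] [BorelSpace G] {μ : Measure G} {p : ℝ≥0∞} {ω : G → ℝ}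

/-- Weighted translates of a compactly supported continuous function are controlled by the value
of the weight at the translating element. -/
theorem exists_weightedNorm_translate_le [BaireSpace G] [μ.IsMulLeftInvariant]
    [IsFiniteMeasureOnCompacts μ] (hω : ∀ t, 0 < ω t)
    (hc : Continuous ω) (hR : ∀ g, ∃ C > 0, ∀ t, ω (t * g) ≤ C * ω t) {g : G → ℂ}
    (hg : Continuous g) (hgs : HasCompactSupport g) :
    ∃ C > 0, ∀ u, weightedNorm μ p ω (translate u g) ≤ ENNReal.ofReal (C * ω u) := by
  obtain ⟨M, hM, h⟩ := exists_le_mul_of_isCompact hω hc hR hgs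
  have hgp : eLpNorm g p μ < ∞ := (hg.memLp_of_hasCompactSupport hgs).2
  refine ⟨M * ((eLpNorm g p μ).toReal + 1), by positivity, fun u => ?_⟩
  have h1 : weightedNorm μ p ω (translate u g) ≤ ENNReal.ofReal (M * ω u) * eLpNorm g p μ := by
    rw [weightedNorm_translate]
    refine eLpNorm_le_mul_eLpNorm_of_ae_le_mul (ae_of_all _ fun t => ?_) p
    by_cases ht : t ∈ tsupport g
    · simp only [norm_mul, Complex.norm_real, Real.norm_of_nonneg (hω _).le]
      rw [mul_comm]
      exact mul_le_mul_of_nonneg_right (h t ht u) (norm_nonneg _)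
    · simp [image_eq_zero_of_notMem_tsupport ht]
  refine h1.trans ?_
  rw [← ENNReal.ofReal_toReal hgp.ne, ← ENNReal.ofReal_mul (mul_pos hM (hω u)).le]
  refine ENNReal.ofReal_le_ofReal ?_
  rw [ENNReal.toReal_ofReal ENNReal.toReal_nonneg]
  nlinarith [mul_pos hM (hω u)]

/-- There is a sequence of compactly supported continuous functions which is dense in the weighted
space. -/
theorem exists_dense_seq [T2Space G] [LocallyCompactSpace G] [SecondCountableTopology G]
    [IsFiniteMeasureOnCompacts μ] (hp : 1 ≤ p) (hp_top : p ≠ ∞) (hω : ∀ t, 0 < ω t)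
    (hc : Continuous ω) :
    ∃ d : ℕ → G → ℂ, (∀ n, Continuous (d n) ∧ HasCompactSupport (d n)) ∧
      ∀ g, MemWeightedLp μ p ω g → ∀ ε : ℝ≥0∞, 0 < ε →
        ∃ n, weightedNorm μ p ω (d n - g) < ε := by
  have : Fact (1 ≤ p) := ⟨hp⟩
  have : Fact (p ≠ ∞) := ⟨hp_top⟩
  let A : Set (Lp ℂ p μ) := {F | ∃ (h : G → ℂ) (hh : MemLp h p μ),
    Continuous h ∧ HasCompactSupport h ∧ F = hh.toLp h}
  have : Nonempty A := ⟨⟨0, 0, MemLp.zero', continuous_const, HasCompactSupport.zero,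
    (MemLp.toLp_zero _).symm⟩⟩
  -- The dense sequence is taken in the separable subspace `A`, not in `Lp`, so that its members are
  -- continuous with compact support; dividing by `ω` then carries it to the weighted space.
  choose h hh hcont hsupp heq using fun n => (TopologicalSpace.denseSeq A n).2
  have hωc : ∀ t, (ω t : ℂ) ≠ 0 := fun t => by exact_mod_cast (hω t).ne'
  refine ⟨fun n t => h n t * (ω t : ℂ)⁻¹, fun n => ⟨?_, ?_⟩, fun g hg ε hε => ?_⟩
  · exact (hcont n).mul ((Complex.continuous_ofReal.comp hc).inv₀ hωc)
  · exact (hsupp n).mul_right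
  · have hε2 : ε / 2 ≠ 0 := (ENNReal.half_pos hε.ne').ne'
    obtain ⟨u, hus, hu, huc, hum⟩ := MemLp.exists_hasCompactSupport_eLpNorm_sub_le hp_top hg hε2
    let U : A := ⟨hum.toLp u, u, hum, huc, hus, rfl⟩
    obtain ⟨_, ⟨n, rfl⟩, hn⟩ := EMetric.mem_closure_iff.1
      (TopologicalSpace.denseRange_denseSeq A U) (ε / 2) (pos_iff_ne_zero.2 hε2)
    refine ⟨n, ?_⟩
    have h1 : eLpNorm (h n - u) p μ < ε / 2 := by
      rw [Subtype.edist_eq, heq n, edist_comm, Lp.edist_toLp_toLp] at hn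
      exact hn
    have h2 : weightedNorm μ p ω ((fun t => h n t * (ω t : ℂ)⁻¹) - g) =
        eLpNorm ((h n - u) + (u - fun t => g t * (ω t : ℂ))) p μ := by
      simp only [weightedNorm]
      congr 1
      ext t
      simp [sub_mul, hωc t]
    rw [h2]
    refine (eLpNorm_add_le ((hh n).sub hum).1 (hum.sub hg).1 hp).trans_lt ?_
    rw [← ENNReal.add_halves ε, eLpNorm_sub_comm u]
    exact ENNReal.add_lt_add_of_lt_of_le (hg.sub hum).2.ne h1 hu

/-- `MemLp.toLp` commutes with finite sums. -/
theorem toLp_sum_range {α : Type*} [MeasurableSpace α] {μ : Measure α} {h : ℕ → α → ℂ}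
    (hh : ∀ k, MemLp (h k) p μ) (N : ℕ) :
    ∑ k ∈ Finset.range N, (hh k).toLp (h k) =
      (memLp_finsetSum' (Finset.range N) fun k _ => hh k).toLp (∑ k ∈ Finset.range N, h k) := by
  induction N with
  | zero => exact (MemLp.toLp_zero _).symm
  | succ N ih =>
    rw [Finset.sum_range_succ, ih, ← MemLp.toLp_add, MemLp.toLp_eq_toLp_iff,
      Finset.sum_range_succ]

/-- An absolutely convergent series in the weighted space converges. -/
theorem exists_tendsto_sum {G : Type*} [TopologicalSpace G] [MeasurableSpace G] [BorelSpace G]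
    {μ : Measure G} {ω : G → ℝ} (hp : 1 ≤ p) (hω : ∀ t, 0 < ω t) (hc : Continuous ω)
    {h : ℕ → G → ℂ} (hm : ∀ k, AEStronglyMeasurable (h k) μ)
    (hb : ∀ k, weightedNorm μ p ω (h k) ≤ ENNReal.ofReal ((1 / 2) ^ k)) :
    ∃ f, MemWeightedLp μ p ω f ∧
      Tendsto (fun N => weightedNorm μ p ω (f - ∑ k ∈ Finset.range N, h k)) atTop (𝓝 0) := by
  have : Fact (1 ≤ p) := ⟨hp⟩
  have hωc : ∀ t, (ω t : ℂ) ≠ 0 := fun t => by exact_mod_cast (hω t).ne'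
  have hmem : ∀ k, MemWeightedLp μ p ω (h k) := fun k =>
    (memWeightedLp_iff hω hc).2 ⟨hm k, (hb k).trans_lt ENNReal.ofReal_lt_top⟩
  -- Multiplication by `ω` moves the series to the complete space `Lp`; the sum is divided by `ω`
  -- afterwards.
  let x : ℕ → Lp ℂ p μ := fun k => (hmem k).toLp _
  have hx : Summable x := by
    refine Summable.of_norm_bounded summable_geometric_two fun k => ?_
    rw [show ‖x k‖ = _ from Lp.norm_toLp _ (hmem k)]
    exact ENNReal.toReal_le_of_le_ofReal (by positivity) (hb k)
  obtain ⟨X, hX⟩ := hx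
  have hlim := tendsto_iff_edist_tendsto_0.1 hX.tendsto_sum_nat
  have hcancel : ∀ t, X t * (ω t : ℂ)⁻¹ * (ω t : ℂ) = X t := fun t => by simp [hωc t]
  refine ⟨fun t => X t * (ω t : ℂ)⁻¹, ?_, ?_⟩
  · rw [MemWeightedLp]
    simp only [hcancel]
    exact Lp.memLp X
  · refine hlim.congr fun N => ?_
    rw [show ∑ k ∈ Finset.range N, x k = _ from toLp_sum_range hmem N, edist_comm,
      ← Lp.toLp_coeFn X (Lp.memLp X), Lp.edist_toLp_toLp]
    simp only [weightedNorm]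
    congr 1
    ext t
    simp [sub_mul, hωc t, Finset.sum_mul]

/-- The elements of a sequence whose mutual quotients make the weight rapidly decreasing. -/
theorem exists_seq_weight_le {G : Type*} [Group G] {ω : G → ℝ}
    (hL : ∀ g, ∃ C > 0, ∀ t, ω (g * t) ≤ C * ω t)
    (hR : ∀ g, ∃ C > 0, ∀ t, ω (t * g) ≤ C * ω t) {S : Set G}
    (hS : ∀ ε > 0, ∃ s ∈ S, ω s < ε ∧ ω s⁻¹ < ε) {C : ℕ → ℝ} (hC : ∀ k, 0 < C k) :
    ∃ s : ℕ → G, (∀ n, s n ∈ S) ∧ (∀ k, C k * ω (s k)⁻¹ ≤ (1 / 2) ^ k) ∧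
      ∀ n k, n ≠ k → C k * ω (s n * (s k)⁻¹) ≤ (1 / 2) ^ n * (1 / 2) ^ k := by
  classical
  choose l hl hlω using hL
  choose r hr hrω using hR
  -- `A` holds the earlier choices without their indices, hence the bound for all `k ≤ n`. Since `ω
  -- (x y⁻¹) ≤ r y⁻¹ * ω x` and `ω (y x⁻¹) ≤ l y * ω x⁻¹`, finitely many smallness conditions on `ω
  -- x` and `ω x⁻¹` suffice.
  have step : ∀ (n : ℕ) (A : Finset G), ∃ x ∈ S, C n * ω x⁻¹ ≤ (1 / 2) ^ n ∧
      ∀ y ∈ A, (∀ k ≤ n, C k * ω (x * y⁻¹) ≤ (1 / 2) ^ n * (1 / 2) ^ n) ∧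
        C n * ω (y * x⁻¹) ≤ (1 / 2) ^ n * (1 / 2) ^ n := by
    intro n A
    have small : ∀ B q : ℝ, 0 < q → ∀ᶠ ε in 𝓝[>] (0 : ℝ), B * ε ≤ q := by
      intro B q hq
      have : Tendsto (fun ε => B * ε) (𝓝[>] (0 : ℝ)) (𝓝 0) := by
        have h : Tendsto (fun ε => B * ε) (𝓝 (0 : ℝ)) (𝓝 (B * 0)) :=
          (continuous_const.mul continuous_id).tendsto 0
        rw [mul_zero] at h
        exact h.mono_left nhdsWithin_le_nhds
      exact this.eventually (ge_mem_nhds hq)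
    have h1 : ∀ᶠ ε in 𝓝[>] (0 : ℝ), ∀ y ∈ A, ∀ k ∈ Finset.range (n + 1),
        C k * r y⁻¹ * ε ≤ (1 / 2) ^ n * (1 / 2) ^ n :=
      (eventually_all_finset A).2 fun y _ => (eventually_all_finset _).2 fun k _ =>
        small _ _ (by positivity)
    have h2 : ∀ᶠ ε in 𝓝[>] (0 : ℝ), ∀ y ∈ A, C n * l y * ε ≤ (1 / 2) ^ n * (1 / 2) ^ n :=
      (eventually_all_finset A).2 fun y _ => small _ _ (by positivity)
    obtain ⟨ε, ⟨⟨h1, h2⟩, h3⟩, hε⟩ :=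
      (((h1.and h2).and (small (C n) ((1 / 2) ^ n) (by positivity))).and
        self_mem_nhdsWithin).exists
    obtain ⟨x, hx, hx1, hx2⟩ := hS ε hε
    refine ⟨x, hx, (mul_le_mul_of_nonneg_left hx2.le (hC n).le).trans h3, fun y hy =>
      ⟨fun k hk => le_trans ?_ (h1 y hy k (by simpa [Nat.lt_succ_iff] using hk)),
        le_trans ?_ (h2 y hy)⟩⟩
    · rw [mul_assoc]
      exact mul_le_mul_of_nonneg_left ((hrω _ _).trans
        (mul_le_mul_of_nonneg_left hx1.le (hr _).le)) (hC k).le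
    · rw [mul_assoc]
      exact mul_le_mul_of_nonneg_left ((hlω _ _).trans
        (mul_le_mul_of_nonneg_left hx2.le (hl _).le)) (hC n).le
  choose x hxS hx1 hx2 using step
  let A : ℕ → Finset G := fun n => Nat.rec ∅ (fun n A => insert (x n A) A) n
  have hA : ∀ n, A (n + 1) = insert (x n (A n)) (A n) := fun n => rfl
  have hmono : Monotone A := monotone_nat_of_le_succ fun n => by
    rw [hA]
    exact Finset.subset_insert _ _
  have hmem : ∀ k n, k < n → x k (A k) ∈ A n := fun k n hkn =>
    hmono (Nat.succ_le_of_lt hkn) (by rw [hA]; exact Finset.mem_insert_self _ _)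
  have hpow : ∀ k n : ℕ, k ≤ n → (1 / 2 : ℝ) ^ n ≤ (1 / 2) ^ k := fun k n h =>
    pow_le_pow_of_le_one (by norm_num) (by norm_num) h
  refine ⟨fun n => x n (A n), fun n => hxS _ _, fun k => hx1 _ _, fun n k hnk => ?_⟩
  rcases lt_or_gt_of_ne hnk with h | h
  · refine ((hx2 k (A k) _ (hmem n k h)).2).trans ?_
    gcongr ?_ * _
    exact hpow _ _ h.le
  · refine ((hx2 n (A n) _ (hmem k n h)).1 k h.le).trans ?_
    gcongr _ * ?_
    exact hpow _ _ h.le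

theorem exists_isSDense_of_iInf_max_eq_zero [T2Space G] [LocallyCompactSpace G]
    [SecondCountableTopology G] [μ.IsMulLeftInvariant] [IsFiniteMeasureOnCompacts μ]
    (hp : 1 ≤ p) (hp_top : p ≠ ∞) (hω : ∀ t, 0 < ω t) (hc : Continuous ω)
    (hL : ∀ g, ∃ C > 0, ∀ t, ω (g * t) ≤ C * ω t)
    (hR : ∀ g, ∃ C > 0, ∀ t, ω (t * g) ≤ C * ω t) {S : Set G}
    (h : (⨅ s ∈ S, ENNReal.ofReal (max (ω s) (ω s⁻¹))) = 0) :
    ∃ f, IsSDense μ p ω S f := by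
  obtain ⟨d, hd, hdense⟩ := exists_dense_seq (μ := μ) hp hp_top hω hc
  -- Unpairing repeats each `d j` at arbitrarily large indices `Nat.pair j m`, where the error `2 ·
  -- 2⁻ⁿ` is as small as desired.
  let g : ℕ → G → ℂ := fun n => d n.unpair.1
  have hg : ∀ n, Continuous (g n) := fun n => (hd _).1
  choose C hC hCg using fun n => exists_weightedNorm_translate_le (μ := μ) (p := p) hω hc hR
    (hg n) (hd n.unpair.1).2
  obtain ⟨s, hsS, hs1, hs2⟩ := exists_seq_weight_le hL hR (iInf_max_eq_zero_iff.1 h) hC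
  have hgm : ∀ n u, AEStronglyMeasurable (translate u (g n)) μ := fun n u =>
    aestronglyMeasurable_translate (hg n).aestronglyMeasurable u
  obtain ⟨f, hf, hlim⟩ := exists_tendsto_sum (μ := μ) hp hω hc (fun k => hgm k (s k)⁻¹)
    fun k => (hCg k _).trans (ENNReal.ofReal_le_ofReal (hs1 k))
  obtain ⟨hfm, hfn⟩ := (memWeightedLp_iff hω hc).1 hf
  have htm : ∀ u, AEStronglyMeasurable (translate u f) μ :=
    aestronglyMeasurable_translate hfm
  have happrox : ∀ n, weightedNorm μ p ω (translate (s n) f - g n) ≤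
      ENNReal.ofReal ((1 / 2) ^ n * 2) := by
    intro n
    -- `D` depends on `n`, which is harmless: `n` is fixed while the tail of the series tends to
    -- zero in `N`.
    obtain ⟨D, -, hD⟩ := hL (s n)
    have hlim' : Tendsto (fun N => ENNReal.ofReal D * weightedNorm μ p ω
        (f - ∑ k ∈ Finset.range N, translate (s k)⁻¹ (g k)) + ENNReal.ofReal ((1 / 2) ^ n * 2))
        atTop (𝓝 (ENNReal.ofReal ((1 / 2) ^ n * 2))) := by
      have := (ENNReal.Tendsto.const_mul hlim (Or.inr (ENNReal.ofReal_ne_top (r := D)))).add_const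
        (ENNReal.ofReal ((1 / 2) ^ n * 2))
      simpa using this
    refine ge_of_tendsto hlim' ?_
    filter_upwards [eventually_gt_atTop n] with N hN
    -- The `k = n` term of the translated partial sum is exactly `g n` and cancels.
    have hsplit : translate (s n) f - g n =
        translate (s n) (f - ∑ k ∈ Finset.range N, translate (s k)⁻¹ (g k)) +
          ∑ k ∈ (Finset.range N).erase n, translate (s n * (s k)⁻¹) (g k) := by
      ext t
      have h1 := Finset.add_sum_erase (Finset.range N)
        (fun k => translate (s n * (s k)⁻¹) (g k) t) (Finset.mem_range.2 hN)
      simp only [translate, mul_inv_cancel, inv_one, one_mul] at h1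
      simp only [translate, Pi.sub_apply, Pi.add_apply, Finset.sum_apply]
      simp only [mul_inv_rev, inv_inv, mul_assoc] at h1 ⊢
      rw [← h1]
      ring
    rw [hsplit]
    refine (weightedNorm_add_le hp hc (aestronglyMeasurable_translate (hfm.sub
      (Finset.aestronglyMeasurable_sum _ fun k _ => hgm k _)) _)
      (Finset.aestronglyMeasurable_sum _ fun k _ => hgm k _)).trans ?_
    refine add_le_add (weightedNorm_translate_le hω hD _) ?_
    refine (weightedNorm_sum_le hp hc (fun k => translate (s n * (s k)⁻¹) (g k))
      (fun k => hgm k _) _).trans ?_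
    calc ∑ k ∈ (Finset.range N).erase n, weightedNorm μ p ω (translate (s n * (s k)⁻¹) (g k))
        ≤ ∑ k ∈ (Finset.range N).erase n, ENNReal.ofReal ((1 / 2) ^ n * (1 / 2) ^ k) :=
          Finset.sum_le_sum fun k hk => (hCg k _).trans
            (ENNReal.ofReal_le_ofReal (hs2 n k (Finset.ne_of_mem_erase hk).symm))
      _ = ENNReal.ofReal ((1 / 2) ^ n * ∑ k ∈ (Finset.range N).erase n, (1 / 2) ^ k) := by
          rw [Finset.mul_sum, ENNReal.ofReal_sum_of_nonneg fun k _ => by positivity]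
      _ ≤ ENNReal.ofReal ((1 / 2) ^ n * 2) := by
          refine ENNReal.ofReal_le_ofReal (mul_le_mul_of_nonneg_left ?_ (by positivity))
          exact (summable_geometric_two.sum_le_tsum _ fun k _ => by positivity).trans_eq
            tsum_geometric_two
  refine ⟨f, hf, fun u _ => ?_, fun v hv ε hε => ?_⟩
  · obtain ⟨D, -, hD⟩ := hL u
    exact (memWeightedLp_iff hω hc).2 ⟨htm u, (weightedNorm_translate_le hω hD f).trans_lt
      (ENNReal.mul_lt_top ENNReal.ofReal_lt_top hfn)⟩
  · have hε2 : 0 < ε / 2 := ENNReal.half_pos hε.ne'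
    obtain ⟨j, hj⟩ := hdense v hv (ε / 2) hε2
    have hsmall : Tendsto (fun n : ℕ => ENNReal.ofReal ((1 / 2) ^ n * 2)) atTop (𝓝 0) := by
      have := ENNReal.tendsto_ofReal ((tendsto_pow_atTop_nhds_zero_of_lt_one
        (by norm_num : (0 : ℝ) ≤ 1 / 2) (by norm_num)).mul_const 2)
      simpa using this
    obtain ⟨m, hm⟩ := (hsmall.eventually_lt_const hε2).exists_forall_of_atTop
    refine ⟨s (Nat.pair j m), hsS _, ?_⟩
    have hgj : g (Nat.pair j m) = d j := by simp [g]
    have h1 := (happrox (Nat.pair j m)).trans_lt (hm _ (Nat.right_le_pair j m))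
    rw [hgj] at h1
    have hsplit : translate (s (Nat.pair j m)) f - v =
        (translate (s (Nat.pair j m)) f - d j) + (d j - v) := by abel
    have hdm := (hd j).1.aestronglyMeasurable (μ := μ)
    rw [hsplit, ← ENNReal.add_halves ε]
    exact (weightedNorm_add_le hp hc ((htm _).sub hdm)
      (hdm.sub ((memWeightedLp_iff hω hc).1 hv).1)).trans_lt (ENNReal.add_lt_add h1 hj)

end Sufficiency

end WeightedTranslation

theorem mainTheorem6 {G : Type*} [Group G] [TopologicalSpace G] [IsTopologicalGroup G]
    [T2Space G] [LocallyCompactSpace G] [SecondCountableTopology G] [NoncompactSpace G]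
    [MeasurableSpace G] [BorelSpace G] (μ : Measure G) [μ.IsHaarMeasure]
    (p : ℝ≥0∞) (hp : 1 ≤ p) (hp_top : p ≠ ∞)
    (ω : G → ℝ) (hω_pos : ∀ t, 0 < ω t) (hω_cont : Continuous ω)
    (hL : ∀ g, WeightedTranslation.leftNorm ω g < ∞)
    (hR : ∀ g, WeightedTranslation.rightNorm ω g < ∞)
    (S : Set G) :
    List.TFAE [
      ∃ f : G → ℂ, WeightedTranslation.IsSDense μ p ω S f,
      ∀ K : Set G, IsCompact K →
        (⨅ s ∈ S, ⨆ t ∈ s • K ∪ s⁻¹ • K, ENNReal.ofReal (ω t)) = 0,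
      (⨅ s ∈ S, ENNReal.ofReal (max (ω s) (ω s⁻¹))) = 0] := by
  have hL' g := WeightedTranslation.exists_le_mul_of_leftNorm_lt_top hω_pos (hL g)
  have hR' g := WeightedTranslation.exists_le_mul_of_rightNorm_lt_top hω_pos (hR g)
  tfae_have 1 → 3 := fun ⟨f, hf⟩ =>
    WeightedTranslation.iInf_max_eq_zero_of_isSDense hp hp_top hω_pos hω_cont hR' hf
  tfae_have 3 → 2 := fun h K hK =>
    WeightedTranslation.iInf_iSup_eq_zero_of_iInf_max_eq_zero hω_pos hω_cont hR' h hK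
  tfae_have 2 → 3 := fun h =>
    WeightedTranslation.iInf_max_eq_zero_of_iInf_iSup_eq_zero (h {1} isCompact_singleton)
  tfae_have 3 → 1 := fun h =>
    WeightedTranslation.exists_isSDense_of_iInf_max_eq_zero hp hp_top hω_pos hω_cont hL' hR' h
  tfae_finish
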